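/- Let $\mathbb D=\{z\in\mathbb C:|z|<1\}$ and let $\mathcal A$ be a complex unital Banach algebra with unit $1_{\mathcal A}$, $\|1_{\mathcal A}\|=1$. Let $\mathcal F=\{F_t\}_{t\ge 0}$ be a one-parameter continuous semigroup on $\mathbb D$: each $F_t:\mathbb D\to\mathbb D$ is holomorphic, $(t,z)\mapsto F_t(z)$ is continuous on $[0,\infty)\times\mathbb D$, $F_{t+s}=F_t\circ F_s$ for all $t,s\ge 0$, and $F_0(z)=z$ for all $z\in\mathbb D$. A family $\{\Gamma_t\}_{t\ge0}$ of holomorphic mappings $\Gamma_t:\mathbb D\to\mathcal A$ such that $(t,z)\mapsto\Gamma_t(z)$ is continuous on $[0,\infty)\times\mathbb D$ is called a semicocycle over $\mathcal F$ if $\Gamma_t(F_s(z))\,\Gamma_s(z)=\Gamma_{t+s}(z)$ for all $t,s\ge0$, $z\in\mathbb D$, and $\Gamma_0(z)=1_{\mathcal A}$ for all $z\in\mathbb D$. For a mapping $B:\mathbb D\to\mathcal A$ consider, for each $z\in\mathbb D$, the evolution problem $$\frac{d u(t,z)}{dt}=B(F_t(z))\,u(t,z)\quad(t\ge0),\qquad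 u(0,z)=1_{\mathcal A},\tag{$*$}$$ where derivatives at $t=0$ are one-sided. (a) Let $B:\mathbb D\to\mathcal A$ be holomorphic. Then for every $z\in\mathbb D$ problem $(*)$ has a unique solution $u(\cdot,z)$ on $[0,\infty)$, and the family $\{\Gamma_t:=u(t,\cdot)\}_{t\ge0}$ is a semicocycle over $\mathcal F$. (b) Let $\{\Gamma_t\}_{t\ge0}$ be a semicocycle over $\mathcal F$. Then for every $z\in\mathbb D$ the function $t\mapsto\Gamma_t(z)$ is differentiable on $[0,\infty)$. The mapping $B(z)=\frac{d}{dt}\Gamma_t(z)\big|_{t=0}$ is holomorphic on $\mathbb D$, and for every $z\in\mathbb D$ the function $t\mapsto\Gamma_t(z)$ is the unique solution of $(*)$ with this $B$. -/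

import Mathlib

open Set Metric

/-- A one-parameter continuous semigroup of holomorphic self-mappings of an open set `D ⊆ ℂ`.
Only the values `F t z` with `0 ≤ t` and `z ∈ D` matter. -/
structure IsHolSemigroup (D : Set ℂ) (F : ℝ → ℂ → ℂ) : Prop where
  mapsTo : ∀ t, 0 ≤ t → MapsTo (F t) D D
  holomorphic : ∀ t, 0 ≤ t → DifferentiableOn ℂ (F t) D
  continuous : ContinuousOn (fun p : ℝ × ℂ => F p.1 p.2) (Ici 0 ×ˢ D)
  add : ∀ t s, 0 ≤ t → 0 ≤ s → ∀ z ∈ D, F (t + s) z = F t (F s z)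
  zero : ∀ z ∈ D, F 0 z = z

/-- `Γ` is a holomorphic `A`-valued semicocycle over the family `F` of self-mappings of `D`.
Only the values `Γ t z` with `0 ≤ t` and `z ∈ D` matter. -/
structure IsSemicocycle {A : Type*} [NormedRing A] [NormedAlgebra ℂ A]
    (D : Set ℂ) (F : ℝ → ℂ → ℂ) (Γ : ℝ → ℂ → A) : Prop where
  holomorphic : ∀ t, 0 ≤ t → DifferentiableOn ℂ (Γ t) D
  continuous : ContinuousOn (fun p : ℝ × ℂ => Γ p.1 p.2) (Ici 0 ×ˢ D)
  chain : ∀ t s, 0 ≤ t → 0 ≤ s → ∀ z ∈ D, Γ t (F s z) * Γ s z = Γ (t + s) z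
  zero : ∀ z ∈ D, Γ 0 z = 1

/-- `v` solves `v'(t) = a(t) v(t)` for `t ≥ 0`, `v(0) = 1`; the derivative is one-sided at `t = 0`
and two-sided at every `t > 0`. -/
def SolvesEvolution {A : Type*} [NormedRing A] [NormedAlgebra ℂ A] (a v : ℝ → A) : Prop :=
  (∀ t, 0 ≤ t → HasDerivWithinAt v (a t * v t) (Ici 0) t) ∧ v 0 = 1

/-- `v` is the solution on `[0, ∞)` of `v'(t) = a(t) v(t)`, `v(0) = 1`, and the only one there. -/
def IsUniqueEvolutionSolution {A : Type*} [NormedRing A] [NormedAlgebra ℂ A]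
    (a v : ℝ → A) : Prop :=
  SolvesEvolution a v ∧ ∀ w : ℝ → A, SolvesEvolution a w → EqOn w v (Ici 0)

/-- The generator `B(z) = d/dt Γ_t(z)` at `t = 0` (right derivative). -/
noncomputable def semicocycleGenerator {A : Type*} [NormedRing A] [NormedAlgebra ℂ A]
    (Γ : ℝ → ℂ → A) (z : ℂ) : A :=
  derivWithin (fun t => Γ t z) (Ici 0) 0

/-!
Part (a). The Peano–Baker series solves `(*)` and converges locally uniformly in `(t, z)`, so the
solution is jointly continuous, and holomorphic in `z`. Both sides of the chain rule solve the same
linear equation in `t`, hence agree by Grönwall uniqueness.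

Part (b). Differentiability in time is extracted from integrals over a short time window. With
`h(z) = ∫₀^ε F_s(z) ds` and `G(z) = ∫₀^ε Γ_s(z) ds`, the semigroup law and the chain rule give
`h(F_t(z)) = ∫_t^{t+ε} F_s(z) ds` and `G(F_t(z)) Γ_t(z) = ∫_t^{t+ε} Γ_s(z) ds`, whose right-hand
sides are `C¹` in `t`. For small `ε` the map `h` is locally invertible at `z` and `G(z)` is an
invertible element, so `t ↦ F_t(z)` and then `t ↦ Γ_t(z)` are differentiable at `0`. Differentiating
at `t = 0` gives, with `f` the generator of the semigroup,
`f h' = F_ε - id` and `G B = Γ_ε - 1 - f G'`, so that `f` and `B` are holomorphic. The chain rule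
moves the right derivative from `0` to every `t ≥ 0`, and uniqueness for right derivatives
identifies `Γ_t(z)` with the solution from (a), which has two-sided derivatives.
-/

open Filter Function MeasureTheory Topology

section TimeIntegrals

variable {E : Type*} [NormedAddCommGroup E]

theorem hasDerivWithinAt_comp_add [NormedSpace ℝ E] {f : ℝ → E} {f' : E} {s s' : Set ℝ} {t c : ℝ}
    (h : HasDerivWithinAt f f' s' (t + c)) (hs : MapsTo (· + c) s s') :
    HasDerivWithinAt (fun x => f (x + c)) f' s t := by
  simpa only [one_smul, comp_def, id_eq] using
    HasDerivWithinAt.scomp t h ((hasDerivAt_id t).add_const c).hasDerivWithinAt hs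

theorem integral_comp_max_left [NormedSpace ℝ E] (g : ℝ → E) {c t : ℝ} (hct : c ≤ t) :
    ∫ s in c..t, g (max s c) = ∫ s in c..t, g s :=
  intervalIntegral.integral_congr fun s hs => by
    rw [uIcc_of_le hct] at hs
    simp only [max_eq_left hs.1]

theorem hasDerivWithinAt_integral_Ici [NormedSpace ℝ E] [CompleteSpace E] {g : ℝ → E} {c t : ℝ}
    (hg : ContinuousOn g (Ici c)) (hct : c ≤ t) :
    HasDerivWithinAt (fun t => ∫ s in c..t, g s) (g t) (Ici c) t := by
  have hext : Continuous fun s => g (max s c) :=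
    hg.comp_continuous (by fun_prop) fun s => le_max_right s c
  have hderiv := (hext.integral_hasStrictDerivAt c t).hasDerivAt.hasDerivWithinAt (s := Ici c)
  rw [max_eq_left hct] at hderiv
  exact hderiv.congr_of_mem (fun t ht => (integral_comp_max_left g ht).symm) hct

theorem hasDerivWithinAt_integral_window [NormedSpace ℝ E] [CompleteSpace E] {g : ℝ → E}
    {c ε t : ℝ} (hg : ContinuousOn g (Ici c)) (hε : 0 ≤ ε) (hct : c ≤ t) :
    HasDerivWithinAt (fun t => ∫ s in t..t + ε, g s) (g (t + ε) - g t) (Ici c) t := by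
  have hmaps : MapsTo (· + ε) (Ici c) (Ici c) := fun x hx => le_add_of_le_of_nonneg hx hε
  have hint : ∀ x ∈ Ici c, IntervalIntegrable g volume c x := fun x hx =>
    (hg.mono (ordConnected_Ici.uIcc_subset self_mem_Ici hx)).intervalIntegrable
  refine ((hasDerivWithinAt_comp_add (hasDerivWithinAt_integral_Ici hg (hmaps hct)) hmaps).sub
    (hasDerivWithinAt_integral_Ici hg hct)).congr_of_mem (fun x hx => ?_) hct
  exact (intervalIntegral.integral_interval_sub_left (hint _ (hmaps hx)) (hint x hx)).symm

theorem exists_pos_isUnit_integral {A : Type*} [NormedRing A] [NormedAlgebra ℝ A]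
    [CompleteSpace A] {g : ℝ → A} {c : ℝ} (hg : ContinuousOn g (Ici c)) (hc : IsUnit (g c)) :
    ∃ ε > 0, IsUnit (∫ s in c..c + ε, g s) := by
  have hslope := hasDerivWithinAt_iff_tendsto_slope.1 (hasDerivWithinAt_integral_Ici hg le_rfl)
  rw [Ici_sdiff_left] at hslope
  obtain ⟨t, hunit, hct⟩ :=
    ((hslope.eventually (Units.isOpen.mem_nhds hc)).and self_mem_nhdsWithin).exists
  have hpos : 0 < t - c := sub_pos.2 hct
  refine ⟨t - c, hpos, ?_⟩
  have hmul := ((IsUnit.mk0 _ hpos.ne').map (algebraMap ℝ A)).mul hunit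
  rwa [slope_def_module, ← Algebra.smul_def, intervalIntegral.integral_same, sub_zero,
    smul_inv_smul₀ hpos.ne', ← add_sub_cancel c t] at hmul

theorem continuousOn_integral_Ici_prod [NormedSpace ℝ E] {X : Type*} [TopologicalSpace X]
    {D : Set X} {φ : ℝ → X → E} {c : ℝ} (hφ : ContinuousOn (uncurry φ) (Ici c ×ˢ D)) :
    ContinuousOn (uncurry fun t x => ∫ s in c..t, φ s x) (Ici c ×ˢ D) := by
  have hext : Continuous (uncurry fun (p : ↥(Ici c ×ˢ D)) s => φ (max s c) p.1.2) :=
    hφ.comp_continuous (f := fun q : ↥(Ici c ×ˢ D) × ℝ => (max q.2 c, q.1.1.2)) (by fun_prop)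
      fun q => ⟨le_max_right q.2 c, q.1.2.2⟩
  rw [continuousOn_iff_continuous_domRestrict]
  exact (intervalIntegral.continuous_parametric_intervalIntegral_of_continuous hext
    (s := fun p => p.1.1) (by fun_prop)).congr fun p =>
      integral_comp_max_left (fun s => φ s p.1.2) p.2.1

end TimeIntegrals

section ParametricFamilies

variable {T X E : Type*} [TopologicalSpace T] [TopologicalSpace X] [NormedAddCommGroup E]

theorem exists_eventually_norm_le_of_isCompact {K : Set T} {D : Set X} {φ : T → X → E}
    (hK : IsCompact K) (hφ : ContinuousOn (uncurry φ) (K ×ˢ D)) {x : X} (hx : x ∈ D) :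
    ∃ M, ∀ᶠ w in 𝓝[D] x, ∀ t ∈ K, ‖φ t w‖ ≤ M := by
  obtain ⟨C, hC⟩ := hK.exists_bound_of_continuousOn (hφ.uncurry_right x hx)
  obtain ⟨V, hV, hclose⟩ := hK.mem_uniformity_of_prod (f := fun w t => φ t w)
    (hφ.comp continuous_swap.continuousOn fun p hp => ⟨hp.2, hp.1⟩) hx
    (Metric.dist_mem_uniformity one_pos)
  refine ⟨C + 1, ?_⟩
  filter_upwards [hV] with w hw t ht
  have hdist : ‖φ t w - φ t x‖ < 1 := by simpa [dist_eq_norm] using hclose w hw t ht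
  linarith [hC t ht, norm_le_norm_add_norm_sub' (φ t w) (φ t x)]

theorem tendstoLocallyUniformlyOn_of_continuousOn_prod {S : Set T} {D : Set X} {φ : T → X → E}
    (hφ : ContinuousOn (uncurry φ) (S ×ˢ D)) {t₀ : T} (ht₀ : t₀ ∈ S) :
    TendstoLocallyUniformlyOn φ (φ t₀) (𝓝[S] t₀) D := by
  rw [tendstoLocallyUniformlyOn_iff_forall_tendsto]
  intro x hx
  have hjoint : Tendsto (uncurry φ) (𝓝[S] t₀ ×ˢ 𝓝[D] x) (𝓝 (φ t₀ x)) := by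
    rw [← nhdsWithin_prod_eq]
    exact hφ (t₀, x) ⟨ht₀, hx⟩
  have hslice : Tendsto (fun p : T × X => φ t₀ p.2) (𝓝[S] t₀ ×ˢ 𝓝[D] x) (𝓝 (φ t₀ x)) :=
    (hφ.uncurry_left t₀ ht₀ x hx).tendsto.comp tendsto_snd
  exact (hslice.prodMk_nhds hjoint).mono_right (nhds_le_uniformity _)

variable [NormedSpace ℂ E] [CompleteSpace E] {D : Set ℂ}

theorem continuousOn_deriv_of_continuousOn_prod {S : Set T} {φ : T → ℂ → E} (hD : IsOpen D)
    (hφ : ContinuousOn (uncurry φ) (S ×ˢ D)) (hol : ∀ t ∈ S, DifferentiableOn ℂ (φ t) D) {z : ℂ}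
    (hz : z ∈ D) : ContinuousOn (fun t => deriv (φ t) z) S := fun _ ht =>
  ((tendstoLocallyUniformlyOn_of_continuousOn_prod hφ ht).deriv
    (eventually_mem_nhdsWithin.mono hol) hD).tendsto_at hz

theorem hasDerivAt_intervalIntegral_of_differentiableOn {φ : ℝ → ℂ → E} {a b : ℝ} (hD : IsOpen D)
    (hφ : ContinuousOn (uncurry φ) (uIcc a b ×ˢ D))
    (hol : ∀ t ∈ uIcc a b, DifferentiableOn ℂ (φ t) D) {z : ℂ} (hz : z ∈ D) :
    HasDerivAt (fun w => ∫ s in a..b, φ s w) (∫ s in a..b, deriv (φ s) z) z := by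
  obtain ⟨M, hM⟩ := exists_eventually_norm_le_of_isCompact isCompact_uIcc hφ hz
  rw [hD.nhdsWithin_eq hz] at hM
  obtain ⟨r, hr, hball⟩ := Metric.eventually_nhds_iff_ball.1 (hM.and (hD.mem_nhds hz))
  have hsub : ∀ w ∈ ball z (r / 2), closedBall w (r / 2) ⊆ ball z r := fun w hw =>
    closedBall_subset_ball' (by linarith [mem_ball.1 hw])
  have hmeas : ∀ {g : ℝ → E}, ContinuousOn g (uIcc a b) →
      AEStronglyMeasurable g (volume.restrict (uIoc a b)) := fun hg =>
    (hg.mono uIoc_subset_uIcc).aestronglyMeasurable measurableSet_uIoc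
  -- Cauchy's estimate on discs of radius `r / 2` dominates the derivatives.
  have hcauchy : ∀ s ∈ uIcc a b, ∀ w ∈ ball z (r / 2), ‖deriv (φ s) w‖ ≤ M / (r / 2) :=
    fun s hs w hw => Complex.norm_deriv_le_of_forall_mem_sphere_norm_le (half_pos hr)
      ((hol s hs).diffContOnCl_ball fun x hx => (hball x (hsub w hw hx)).2)
      fun x hx => (hball x (hsub w hw (sphere_subset_closedBall hx))).1 s hs
  refine (intervalIntegral.hasDerivAt_integral_of_dominated_loc_of_deriv_le
    (F := fun w s => φ s w) (F' := fun w s => deriv (φ s) w) (bound := fun _ => M / (r / 2))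
    (ball_mem_nhds z (half_pos hr)) ?_ (hφ.uncurry_right z hz).intervalIntegrable
    (hmeas (continuousOn_deriv_of_continuousOn_prod hD hφ hol hz)) ?_ intervalIntegrable_const
    ?_).2
  · filter_upwards [hD.mem_nhds hz] with w hw using hmeas (hφ.uncurry_right w hw)
  · exact Eventually.of_forall fun s hs => hcauchy s (uIoc_subset_uIcc hs)
  · refine Eventually.of_forall fun s hs w hw => DifferentiableAt.hasDerivAt ?_
    have hwD : w ∈ D := (hball w (hsub w hw (mem_closedBall_self (half_pos hr).le))).2
    exact (hol s (uIoc_subset_uIcc hs)).differentiableAt (hD.mem_nhds hwD)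

theorem differentiableOn_intervalIntegral {φ : ℝ → ℂ → E} {a b : ℝ} (hD : IsOpen D)
    (hφ : ContinuousOn (uncurry φ) (uIcc a b ×ˢ D))
    (hol : ∀ t ∈ uIcc a b, DifferentiableOn ℂ (φ t) D) :
    DifferentiableOn ℂ (fun w => ∫ s in a..b, φ s w) D := fun _ hz =>
  (hasDerivAt_intervalIntegral_of_differentiableOn hD hφ hol hz).differentiableAt
    |>.differentiableWithinAt

end ParametricFamilies

section PeanoBaker

variable {A : Type*} [NormedRing A] [NormedSpace ℝ A]

/-- The `n`-th term of the Peano–Baker series of `v' = a v`, `v 0 = 1`: the `n`-fold iterated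
integral of `a`, obtained by Picard iteration from the constant `1`. -/
noncomputable def peanoBakerTerm (a : ℝ → A) : ℕ → ℝ → A
  | 0, _ => 1
  | n + 1, t => ∫ s in 0..t, a s * peanoBakerTerm a n s

/-- The sum of the Peano–Baker series, which solves `v' = a v`, `v 0 = 1` on `[0, ∞)` when `a` is
continuous there. -/
noncomputable def peanoBaker (a : ℝ → A) (t : ℝ) : A :=
  ∑' n, peanoBakerTerm a n t

theorem norm_peanoBakerTerm_le {a : ℝ → A} {M t : ℝ} (ha : ∀ s ∈ Icc 0 t, ‖a s‖ ≤ M)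
    (ht : 0 ≤ t) (n : ℕ) : ‖peanoBakerTerm a n t‖ ≤ ‖(1 : A)‖ * ((M * t) ^ n / n.factorial) := by
  induction n generalizing t with
  | zero => simp [peanoBakerTerm]
  | succ n ih =>
    have hbound : ∀ s ∈ Ioc 0 t,
        ‖a s * peanoBakerTerm a n s‖ ≤ ‖(1 : A)‖ * M ^ (n + 1) / n.factorial * s ^ n := by
      intro s hs
      have has : ‖a s‖ ≤ M := ha s (Ioc_subset_Icc_self hs)
      calc ‖a s * peanoBakerTerm a n s‖ ≤ ‖a s‖ * ‖peanoBakerTerm a n s‖ := norm_mul_le _ _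
        _ ≤ M * (‖(1 : A)‖ * ((M * s) ^ n / n.factorial)) :=
          mul_le_mul has (ih (fun r hr => ha r ⟨hr.1, hr.2.trans hs.2⟩) hs.1.le) (norm_nonneg _)
            ((norm_nonneg _).trans has)
        _ = ‖(1 : A)‖ * M ^ (n + 1) / n.factorial * s ^ n := by ring
    calc ‖peanoBakerTerm a (n + 1) t‖
        ≤ ∫ s in 0..t, ‖(1 : A)‖ * M ^ (n + 1) / n.factorial * s ^ n :=
          intervalIntegral.norm_integral_le_of_norm_le ht (Eventually.of_forall hbound)
            (Continuous.intervalIntegrable (by fun_prop) _ _)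
      _ = ‖(1 : A)‖ * ((M * t) ^ (n + 1) / (n + 1).factorial) := by
        rw [intervalIntegral.integral_const_mul, integral_pow, zero_pow n.succ_ne_zero, sub_zero,
          Nat.factorial_succ]
        push_cast
        field_simp
        rw [mul_pow]
        ring

theorem norm_peanoBakerTerm_le_of_mem_Icc {a : ℝ → A} {M T t : ℝ}
    (ha : ∀ s ∈ Icc 0 T, ‖a s‖ ≤ M) (ht : t ∈ Icc 0 T) (n : ℕ) :
    ‖peanoBakerTerm a n t‖ ≤ ‖(1 : A)‖ * ((M * T) ^ n / n.factorial) := by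
  have hM : 0 ≤ M := (norm_nonneg _).trans (ha t ht)
  refine (norm_peanoBakerTerm_le (fun s hs => ha s ⟨hs.1, hs.2.trans ht.2⟩) ht.1 n).trans ?_
  gcongr
  exacts [mul_nonneg hM ht.1, ht.2]

section Parameter

variable {X : Type*} [TopologicalSpace X] {D : Set X} {a : ℝ → X → A}

theorem continuousOn_peanoBakerTerm (ha : ContinuousOn (uncurry a) (Ici 0 ×ˢ D)) (n : ℕ) :
    ContinuousOn (uncurry fun t x => peanoBakerTerm (a · x) n t) (Ici 0 ×ˢ D) := by
  induction n with
  | zero => exact continuousOn_const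
  | succ n ih => exact continuousOn_integral_Ici_prod (ha.mul ih)

theorem exists_eventually_norm_peanoBakerTerm_le (ha : ContinuousOn (uncurry a) (Ici 0 ×ˢ D))
    (T : ℝ) {x : X} (hx : x ∈ D) :
    ∃ M, ∀ᶠ w in 𝓝[D] x, ∀ t ∈ Icc 0 T, ∀ n,
      ‖peanoBakerTerm (a · w) n t‖ ≤ ‖(1 : A)‖ * ((M * T) ^ n / n.factorial) := by
  obtain ⟨M, hM⟩ := exists_eventually_norm_le_of_isCompact isCompact_Icc
    (ha.mono (prod_mono_left Icc_subset_Ici_self)) hx (K := Icc 0 T)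
  exact ⟨M, hM.mono fun w hw t ht n => norm_peanoBakerTerm_le_of_mem_Icc hw ht n⟩

variable [CompleteSpace A]

theorem continuousOn_peanoBaker (ha : ContinuousOn (uncurry a) (Ici 0 ×ˢ D)) :
    ContinuousOn (uncurry fun t x => peanoBaker (a · x) t) (Ici 0 ×ˢ D) := by
  rintro ⟨t, x⟩ ⟨ht, hx⟩
  obtain ⟨M, hM⟩ := exists_eventually_norm_peanoBakerTerm_le ha (t + 1) hx
  let V := {w ∈ D | ∀ s ∈ Icc 0 (t + 1), ∀ n,
    ‖peanoBakerTerm (a · w) n s‖ ≤ ‖(1 : A)‖ * ((M * (t + 1)) ^ n / n.factorial)}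
  have hnhds : Icc 0 (t + 1) ×ˢ V ∈ 𝓝[Ici 0 ×ˢ D] (t, x) := by
    rw [nhdsWithin_prod_eq]
    refine prod_mem_prod ?_ (inter_mem self_mem_nhdsWithin hM)
    rw [← Ici_inter_Iic]
    exact inter_mem_nhdsWithin _ (Iic_mem_nhds (lt_add_one t))
  have hsum : ContinuousOn (uncurry fun t x => peanoBaker (a · x) t) (Icc 0 (t + 1) ×ˢ V) :=
    continuousOn_tsum (fun n => (continuousOn_peanoBakerTerm ha n).mono
      (prod_mono Icc_subset_Ici_self (sep_subset D _)))
      ((Real.summable_pow_div_factorial _).mul_left _) fun n p hp => hp.2.2 p.1 hp.1 n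
  exact (hsum _ (mem_of_mem_nhdsWithin (mk_mem_prod ht hx) hnhds)).mono_of_mem_nhdsWithin hnhds

end Parameter

section Solution

variable [CompleteSpace A] {a : ℝ → A}

theorem summable_peanoBakerTerm (ha : ContinuousOn a (Ici 0)) {t : ℝ} (ht : 0 ≤ t) :
    Summable fun n => peanoBakerTerm a n t := by
  obtain ⟨M, hM⟩ := isCompact_Icc.exists_bound_of_continuousOn
    (ha.mono (Icc_subset_Ici_self : Icc 0 t ⊆ Ici 0))
  exact .of_norm_bounded ((Real.summable_pow_div_factorial _).mul_left _)
    (norm_peanoBakerTerm_le hM ht)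

theorem hasSum_integral_mul_peanoBakerTerm (ha : ContinuousOn a (Ici 0)) {t : ℝ} (ht : 0 ≤ t) :
    HasSum (fun n => peanoBakerTerm a (n + 1) t) (∫ s in 0..t, a s * peanoBaker a s) := by
  obtain ⟨M, hM⟩ := isCompact_Icc.exists_bound_of_continuousOn
    (ha.mono (Icc_subset_Ici_self : Icc 0 t ⊆ Ici 0))
  have hsub : uIoc 0 t ⊆ Icc 0 t := by
    rw [uIoc_of_le ht]
    exact Ioc_subset_Icc_self
  have hterm : ∀ n, ContinuousOn (peanoBakerTerm a n) (Ici 0) := fun n =>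
    (continuousOn_peanoBakerTerm (D := univ) (a := fun s (_ : Unit) => a s)
      (ha.comp continuousOn_fst fun _ hp => hp.1) n).uncurry_right () (mem_univ _)
  have hbound : ∀ n, ∀ s ∈ uIoc 0 t,
      ‖a s * peanoBakerTerm a n s‖ ≤ M * (‖(1 : A)‖ * ((M * t) ^ n / n.factorial)) := by
    intro n s hs
    have has : ‖a s‖ ≤ M := hM s (hsub hs)
    exact (norm_mul_le _ _).trans (mul_le_mul has (norm_peanoBakerTerm_le_of_mem_Icc hM (hsub hs) n)
      (norm_nonneg _) ((norm_nonneg _).trans has))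
  refine intervalIntegral.hasSum_integral_of_dominated_convergence
    (bound := fun n _ => M * (‖(1 : A)‖ * ((M * t) ^ n / n.factorial))) (fun n => ?_)
    (fun n => Eventually.of_forall (hbound n))
    (Eventually.of_forall fun _ _ => ((Real.summable_pow_div_factorial _).mul_left _).mul_left M)
    intervalIntegrable_const (Eventually.of_forall fun s hs => ?_)
  · exact ((ha.mul (hterm n)).mono (hsub.trans Icc_subset_Ici_self)).aestronglyMeasurable
      measurableSet_uIoc
  · exact (summable_peanoBakerTerm ha (hsub hs).1).hasSum.mul_left (a s)

theorem peanoBaker_eq_one_add_integral (ha : ContinuousOn a (Ici 0)) {t : ℝ} (ht : 0 ≤ t) :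
    peanoBaker a t = 1 + ∫ s in 0..t, a s * peanoBaker a s := by
  rw [peanoBaker, (summable_peanoBakerTerm ha ht).tsum_eq_zero_add, peanoBakerTerm,
    (hasSum_integral_mul_peanoBakerTerm ha ht).tsum_eq]

theorem hasDerivWithinAt_peanoBaker (ha : ContinuousOn a (Ici 0)) {t : ℝ} (ht : 0 ≤ t) :
    HasDerivWithinAt (peanoBaker a) (a t * peanoBaker a t) (Ici 0) t := by
  have hcont : ContinuousOn (peanoBaker a) (Ici 0) :=
    (continuousOn_peanoBaker (D := univ) (a := fun s (_ : Unit) => a s)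
      (ha.comp continuousOn_fst fun _ hp => hp.1)).uncurry_right () (mem_univ _)
  exact ((hasDerivWithinAt_integral_Ici (ha.mul hcont) ht).const_add 1).congr_of_mem
    (fun s hs => peanoBaker_eq_one_add_integral ha hs) ht

end Solution

end PeanoBaker

theorem eqOn_Ici_of_hasDerivWithinAt_mul {A : Type*} [NormedRing A] [NormedSpace ℝ A]
    {a v w : ℝ → A} {c : ℝ} (ha : ContinuousOn a (Ici c))
    (hv : ContinuousOn v (Ici c)) (hw : ContinuousOn w (Ici c))
    (hv' : ∀ t ∈ Ici c, HasDerivWithinAt v (a t * v t) (Ici t) t)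
    (hw' : ∀ t ∈ Ici c, HasDerivWithinAt w (a t * w t) (Ici t) t) (hc : v c = w c) :
    EqOn v w (Ici c) := by
  intro b hb
  obtain ⟨M, hM⟩ := isCompact_Icc.exists_bound_of_continuousOn
    (ha.mono (Icc_subset_Ici_self : Icc c b ⊆ Ici c))
  have hlip : ∀ t ∈ Ico c b, LipschitzOnWith M.toNNReal (a t * ·) univ := fun t ht =>
    LipschitzOnWith.of_dist_le_mul fun x _ y _ => by
      rw [dist_eq_norm, dist_eq_norm, ← mul_sub]
      refine (norm_mul_le _ _).trans ?_
      gcongr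
      exact (hM t (Ico_subset_Icc_self ht)).trans (Real.le_coe_toNNReal M)
  exact ODE_solution_unique_of_mem_Icc_right hlip
    (hv.mono Icc_subset_Ici_self) (fun t ht => hv' t ht.1) (fun _ _ => mem_univ _)
    (hw.mono Icc_subset_Ici_self) (fun t ht => hw' t ht.1) (fun _ _ => mem_univ _) hc ⟨hb, le_rfl⟩

section Holomorphic

variable {A : Type*} [NormedRing A] [NormedAlgebra ℂ A] [CompleteSpace A] {D : Set ℂ}
  {a : ℝ → ℂ → A}

theorem differentiableOn_peanoBakerTerm (hD : IsOpen D)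
    (ha : ContinuousOn (uncurry a) (Ici 0 ×ˢ D)) (hol : ∀ t, 0 ≤ t → DifferentiableOn ℂ (a t) D)
    (n : ℕ) {t : ℝ} (ht : 0 ≤ t) :
    DifferentiableOn ℂ (fun z => peanoBakerTerm (a · z) n t) D := by
  induction n generalizing t with
  | zero => exact differentiableOn_const _
  | succ n ih =>
    have hsub : uIcc 0 t ⊆ Ici 0 := ordConnected_Ici.uIcc_subset self_mem_Ici ht
    exact differentiableOn_intervalIntegral hD
      ((ha.mul (continuousOn_peanoBakerTerm ha n)).mono (prod_mono_left hsub))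
      fun s hs => (hol s (hsub hs)).mul (ih (hsub hs))

theorem differentiableOn_peanoBaker (hD : IsOpen D)
    (ha : ContinuousOn (uncurry a) (Ici 0 ×ˢ D)) (hol : ∀ t, 0 ≤ t → DifferentiableOn ℂ (a t) D)
    {t : ℝ} (ht : 0 ≤ t) : DifferentiableOn ℂ (fun z => peanoBaker (a · z) t) D := by
  intro z hz
  obtain ⟨M, hM⟩ := exists_eventually_norm_peanoBakerTerm_le ha t hz
  rw [hD.nhdsWithin_eq hz] at hM
  obtain ⟨U, hU, hUo, hzU⟩ := _root_.eventually_nhds_iff.1 (hM.and (hD.mem_nhds hz))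
  have hsum : DifferentiableOn ℂ (fun z => peanoBaker (a · z) t) U :=
    Complex.differentiableOn_tsum_of_summable_norm ((Real.summable_pow_div_factorial _).mul_left _)
      (fun n => (differentiableOn_peanoBakerTerm hD ha hol n ht).mono fun w hw => (hU w hw).2) hUo
      fun n w hw => (hU w hw).1 t ⟨ht, le_rfl⟩ n
  exact (hsum.differentiableAt (hUo.mem_nhds hzU)).differentiableWithinAt

end Holomorphic

namespace SolvesEvolution

variable {A : Type*} [NormedRing A] [NormedAlgebra ℂ A] {a v w : ℝ → A}

theorem continuousOn (hv : SolvesEvolution a v) : ContinuousOn v (Ici 0) := fun t ht =>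
  (hv.1 t ht).continuousWithinAt

theorem hasDerivWithinAt_Ici (hv : SolvesEvolution a v) {t : ℝ} (ht : t ∈ Ici 0) :
    HasDerivWithinAt v (a t * v t) (Ici t) t :=
  (hv.1 t ht).mono (Ici_subset_Ici.2 ht)

theorem congr (hv : SolvesEvolution a v) (h : EqOn w v (Ici 0)) : SolvesEvolution a w :=
  ⟨fun t ht => by simpa only [h ht] using (hv.1 t ht).congr_of_mem h ht,
    (h self_mem_Ici).trans hv.2⟩

theorem eqOn_of_hasDerivWithinAt_Ici (hv : SolvesEvolution a v) (ha : ContinuousOn a (Ici 0))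
    (hw : ContinuousOn w (Ici 0)) (hw' : ∀ t ∈ Ici 0, HasDerivWithinAt w (a t * w t) (Ici t) t)
    (hw0 : w 0 = 1) : EqOn w v (Ici 0) :=
  eqOn_Ici_of_hasDerivWithinAt_mul ha hw hv.continuousOn hw'
    (fun _ => hv.hasDerivWithinAt_Ici) (hw0.trans hv.2.symm)

theorem isUnique (hv : SolvesEvolution a v) (ha : ContinuousOn a (Ici 0)) :
    IsUniqueEvolutionSolution a v :=
  ⟨hv, fun _ hw =>
    hv.eqOn_of_hasDerivWithinAt_Ici ha hw.continuousOn (fun _ => hw.hasDerivWithinAt_Ici) hw.2⟩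

end SolvesEvolution

theorem solvesEvolution_peanoBaker {A : Type*} [NormedRing A] [NormedAlgebra ℂ A]
    [CompleteSpace A] {a : ℝ → A} (ha : ContinuousOn a (Ici 0)) :
    SolvesEvolution a (peanoBaker a) :=
  ⟨fun _ => hasDerivWithinAt_peanoBaker ha, by
    rw [peanoBaker_eq_one_add_integral ha le_rfl, intervalIntegral.integral_same, add_zero]⟩

namespace IsHolSemigroup

variable {A : Type*} [NormedRing A] [NormedAlgebra ℂ A] {D : Set ℂ} {F : ℝ → ℂ → ℂ} {B : ℂ → A}
  {u : ℝ → ℂ → A}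

theorem continuousOn_comp {E : Type*} [TopologicalSpace E] {B : ℂ → E}
    (hF : IsHolSemigroup D F) (hB : ContinuousOn B D) :
    ContinuousOn (uncurry fun t z => B (F t z)) (Ici 0 ×ˢ D) :=
  hB.comp hF.continuous fun p hp => hF.mapsTo p.1 hp.1 hp.2

theorem continuousOn_comp_orbit {E : Type*} [TopologicalSpace E] {B : ℂ → E}
    (hF : IsHolSemigroup D F) (hB : ContinuousOn B D) {z : ℂ} (hz : z ∈ D) :
    ContinuousOn (fun t => B (F t z)) (Ici 0) :=
  (hF.continuousOn_comp hB).uncurry_right z hz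

theorem chain_of_solvesEvolution (hF : IsHolSemigroup D F) (hB : ContinuousOn B D)
    (hu : ∀ z ∈ D, SolvesEvolution (fun t => B (F t z)) (fun t => u t z)) {s t : ℝ} (hs : 0 ≤ s)
    (ht : 0 ≤ t) {z : ℂ} (hz : z ∈ D) : u t (F s z) * u s z = u (t + s) z := by
  have hsz : F s z ∈ D := hF.mapsTo s hs hz
  have hmaps : MapsTo (· + s) (Ici 0) (Ici 0) := fun r hr => le_add_of_le_of_nonneg hr hs
  refine eqOn_Ici_of_hasDerivWithinAt_mul (a := fun t => B (F t (F s z)))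
    (v := fun t => u t (F s z) * u s z) (w := fun t => u (t + s) z)
    (hF.continuousOn_comp_orbit hB hsz) ((hu _ hsz).continuousOn.mul continuousOn_const)
    ((hu z hz).continuousOn.comp (by fun_prop) hmaps) (fun t ht => ?_) (fun t ht => ?_) ?_ ht
  · simpa only [mul_assoc] using ((hu _ hsz).hasDerivWithinAt_Ici ht).mul_const (u s z)
  · rw [← hF.add t s ht hs z hz]
    exact hasDerivWithinAt_comp_add ((hu z hz).hasDerivWithinAt_Ici (hmaps ht))
      fun r hr => add_le_add_left hr s
  · simp only [(hu _ hsz).2, one_mul, zero_add]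

theorem isSemicocycle_of_solvesEvolution [CompleteSpace A] (hF : IsHolSemigroup D F)
    (hD : IsOpen D) (hB : DifferentiableOn ℂ B D)
    (hu : ∀ z ∈ D, SolvesEvolution (fun t => B (F t z)) (fun t => u t z)) :
    IsSemicocycle D F u := by
  have hBF := hF.continuousOn_comp hB.continuousOn
  have hBFhol : ∀ t, 0 ≤ t → DifferentiableOn ℂ (fun z => B (F t z)) D := fun t ht =>
    hB.comp (hF.holomorphic t ht) (hF.mapsTo t ht)
  have hseries : ∀ t, 0 ≤ t → ∀ z ∈ D, u t z = peanoBaker (fun t => B (F t z)) t := by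
    intro t ht z hz
    have hBz := hF.continuousOn_comp_orbit hB.continuousOn hz
    exact ((solvesEvolution_peanoBaker hBz).isUnique hBz).2 _ (hu z hz) ht
  exact
    { holomorphic := fun t ht => (differentiableOn_peanoBaker hD hBF hBFhol ht).congr (hseries t ht)
      continuous := (continuousOn_peanoBaker hBF).congr fun p hp => hseries p.1 hp.1 p.2 hp.2
      chain := fun t s ht hs z hz => hF.chain_of_solvesEvolution hB.continuousOn hu hs ht hz
      zero := fun z hz => (hu z hz).2 }

end IsHolSemigroup

/-- The integral `∫₀^ε φ_s(z) ds` of a family of maps over the initial time window `[0, ε]`. For a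
semigroup or a semicocycle it replaces the merely continuous dependence on time by a `C¹` one. -/
noncomputable def timeIntegral {E : Type*} [NormedAddCommGroup E] [NormedSpace ℝ E]
    (φ : ℝ → ℂ → E) (ε : ℝ) (z : ℂ) : E :=
  ∫ s in 0..ε, φ s z

/-- The infinitesimal generator `f(z) = d/dt F_t(z)` at `t = 0` (right derivative) of a semigroup
of holomorphic maps. -/
noncomputable def semigroupGenerator (F : ℝ → ℂ → ℂ) (z : ℂ) : ℂ :=
  derivWithin (fun t => F t z) (Ici 0) 0

section TimeIntegral

variable {E : Type*} [NormedAddCommGroup E] [NormedSpace ℂ E] [CompleteSpace E] {D : Set ℂ}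
  {φ : ℝ → ℂ → E} {ε : ℝ}

theorem hasDerivAt_timeIntegral (hD : IsOpen D) (hφ : ContinuousOn (uncurry φ) (Ici 0 ×ˢ D))
    (hol : ∀ t, 0 ≤ t → DifferentiableOn ℂ (φ t) D) (hε : 0 ≤ ε) {z : ℂ} (hz : z ∈ D) :
    HasDerivAt (timeIntegral φ ε) (∫ s in 0..ε, deriv (φ s) z) z := by
  have hsub : uIcc 0 ε ⊆ Ici 0 := ordConnected_Ici.uIcc_subset self_mem_Ici hε
  exact hasDerivAt_intervalIntegral_of_differentiableOn hD (hφ.mono (prod_mono_left hsub))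
    (fun t ht => hol t (hsub ht)) hz

theorem differentiableOn_timeIntegral (hD : IsOpen D) (hφ : ContinuousOn (uncurry φ) (Ici 0 ×ˢ D))
    (hol : ∀ t, 0 ≤ t → DifferentiableOn ℂ (φ t) D) (hε : 0 ≤ ε) :
    DifferentiableOn ℂ (timeIntegral φ ε) D := fun _ hz =>
  (hasDerivAt_timeIntegral hD hφ hol hε hz).differentiableAt.differentiableWithinAt

end TimeIntegral

namespace IsHolSemigroup

variable {D : Set ℂ} {F : ℝ → ℂ → ℂ} {ε t : ℝ} {z : ℂ}

theorem timeIntegral_orbit (hF : IsHolSemigroup D F) (hε : 0 ≤ ε) (ht : 0 ≤ t) (hz : z ∈ D) :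
    timeIntegral F ε (F t z) = ∫ s in t..t + ε, F s z := by
  calc timeIntegral F ε (F t z) = ∫ s in 0..ε, F (s + t) z :=
        intervalIntegral.integral_congr fun s hs =>
          (hF.add s t (ordConnected_Ici.uIcc_subset self_mem_Ici hε hs) ht z hz).symm
    _ = ∫ s in t..t + ε, F s z := by
        rw [intervalIntegral.integral_comp_add_right (fun s => F s z) t, zero_add, add_comm ε]

theorem hasDerivWithinAt_timeIntegral_orbit (hF : IsHolSemigroup D F) (hε : 0 ≤ ε) (hz : z ∈ D) :
    HasDerivWithinAt (fun t => timeIntegral F ε (F t z)) (F ε z - z) (Ici 0) 0 := by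
  have hwindow := hasDerivWithinAt_integral_window (hF.continuous.uncurry_right z hz) hε le_rfl
  rw [zero_add, hF.zero z hz] at hwindow
  exact hwindow.congr_of_mem (fun t ht => hF.timeIntegral_orbit hε ht hz) self_mem_Ici

theorem exists_pos_deriv_timeIntegral_ne_zero (hF : IsHolSemigroup D F) (hD : IsOpen D)
    (hz : z ∈ D) : ∃ ε > 0, deriv (timeIntegral F ε) z ≠ 0 := by
  have hone : deriv (F 0) z = 1 := by
    rw [(eventuallyEq_of_mem (hD.mem_nhds hz) hF.zero).deriv_eq, deriv_id'']
  obtain ⟨ε, hε, hunit⟩ := exists_pos_isUnit_integral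
    (continuousOn_deriv_of_continuousOn_prod hD hF.continuous hF.holomorphic hz)
    (hone ▸ isUnit_one)
  refine ⟨ε, hε, ?_⟩
  rw [(hasDerivAt_timeIntegral hD hF.continuous hF.holomorphic hε.le hz).deriv, ← zero_add ε]
  exact hunit.ne_zero

theorem differentiableWithinAt_zero (hF : IsHolSemigroup D F) (hD : IsOpen D) (hz : z ∈ D) :
    DifferentiableWithinAt ℝ (fun t => F t z) (Ici 0) 0 := by
  obtain ⟨ε, hε, hne⟩ := hF.exists_pos_deriv_timeIntegral_ne_zero hD hz
  have hstrict : HasStrictDerivAt (timeIntegral F ε) (deriv (timeIntegral F ε) z) z :=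
    ((differentiableOn_timeIntegral hD hF.continuous hF.holomorphic hε.le).analyticAt
      (hD.mem_nhds hz)).hasStrictDerivAt
  have hinv : DifferentiableAt ℝ (hstrict.localInverse _ _ _ hne) (timeIntegral F ε (F 0 z)) := by
    rw [hF.zero z hz]
    exact (hstrict.to_localInverse hne).hasDerivAt.differentiableAt.restrictScalars ℝ
  have horbit : Tendsto (fun t => F t z) (𝓝[Ici 0] 0) (𝓝 z) := by
    simpa only [ContinuousWithinAt, hF.zero z hz] using
      hF.continuous.uncurry_right z hz 0 self_mem_Ici
  refine (hinv.comp_differentiableWithinAt 0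
    (hF.hasDerivWithinAt_timeIntegral_orbit hε.le hz).differentiableWithinAt)
    |>.congr_of_eventuallyEq_of_mem ?_ self_mem_Ici
  exact (horbit.eventually (hstrict.eventually_left_inverse hne)).mono fun t ht => ht.symm

theorem hasDerivWithinAt_comp_orbit {E : Type*} [NormedAddCommGroup E] [NormedSpace ℂ E]
    (hF : IsHolSemigroup D F) (hD : IsOpen D) {g : ℂ → E} (hg : DifferentiableOn ℂ g D)
    (hz : z ∈ D) :
    HasDerivWithinAt (fun t => g (F t z)) (semigroupGenerator F z • deriv g z) (Ici 0) 0 := by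
  have hgz : HasDerivAt g (deriv g z) (F 0 z) := by
    rw [hF.zero z hz]
    exact (hg.differentiableAt (hD.mem_nhds hz)).hasDerivAt
  exact HasDerivAt.scomp_hasDerivWithinAt 0 hgz
    (hF.differentiableWithinAt_zero hD hz).hasDerivWithinAt

theorem semigroupGenerator_mul_deriv_timeIntegral (hF : IsHolSemigroup D F) (hD : IsOpen D)
    (hε : 0 ≤ ε) (hz : z ∈ D) :
    semigroupGenerator F z * deriv (timeIntegral F ε) z = F ε z - z :=
  (uniqueDiffWithinAt_Ici 0).eq_deriv _ (hF.hasDerivWithinAt_comp_orbit hD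
    (differentiableOn_timeIntegral hD hF.continuous hF.holomorphic hε) hz)
    (hF.hasDerivWithinAt_timeIntegral_orbit hε hz)

theorem differentiableOn_semigroupGenerator (hF : IsHolSemigroup D F) (hD : IsOpen D) :
    DifferentiableOn ℂ (semigroupGenerator F) D := by
  intro z hz
  obtain ⟨ε, hε, hne⟩ := hF.exists_pos_deriv_timeIntegral_ne_zero hD hz
  have hderiv : DifferentiableAt ℂ (deriv (timeIntegral F ε)) z :=
    ((differentiableOn_timeIntegral hD hF.continuous hF.holomorphic hε.le).deriv hD)
      |>.differentiableAt (hD.mem_nhds hz)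
  have hquot : DifferentiableAt ℂ (fun w => (F ε w - w) / deriv (timeIntegral F ε) w) z :=
    (((hF.holomorphic ε hε.le).differentiableAt (hD.mem_nhds hz)).sub differentiableAt_id).div
      hderiv hne
  refine (hquot.congr_of_eventuallyEq ?_).differentiableWithinAt
  filter_upwards [hD.mem_nhds hz, hderiv.continuousAt.eventually_ne hne] with w hw hwne
  exact eq_div_of_mul_eq hwne (hF.semigroupGenerator_mul_deriv_timeIntegral hD hε.le hw)

end IsHolSemigroup

namespace IsSemicocycle

variable {A : Type*} [NormedRing A] [NormedAlgebra ℂ A] [CompleteSpace A] {D : Set ℂ}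
  {F : ℝ → ℂ → ℂ} {Γ : ℝ → ℂ → A} {ε t : ℝ} {z : ℂ}

theorem timeIntegral_mul (hΓ : IsSemicocycle D F Γ) (hF : IsHolSemigroup D F) (hε : 0 ≤ ε)
    (ht : 0 ≤ t) (hz : z ∈ D) :
    timeIntegral Γ ε (F t z) * Γ t z = ∫ s in t..t + ε, Γ s z := by
  have hsub : uIcc 0 ε ⊆ Ici 0 := ordConnected_Ici.uIcc_subset self_mem_Ici hε
  have hint : IntervalIntegrable (fun s => Γ s (F t z)) volume 0 ε :=
    ((hΓ.continuous.uncurry_right _ (hF.mapsTo t ht hz)).mono hsub).intervalIntegrable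
  calc timeIntegral Γ ε (F t z) * Γ t z = ∫ s in 0..ε, Γ s (F t z) * Γ t z :=
        (((ContinuousLinearMap.mul ℝ A).flip (Γ t z)).intervalIntegral_comp_comm hint).symm
    _ = ∫ s in 0..ε, Γ (s + t) z :=
        intervalIntegral.integral_congr fun s hs => hΓ.chain s t (hsub hs) ht z hz
    _ = ∫ s in t..t + ε, Γ s z := by
        rw [intervalIntegral.integral_comp_add_right (fun s => Γ s z) t, zero_add, add_comm ε]

theorem hasDerivWithinAt_timeIntegral_mul (hΓ : IsSemicocycle D F Γ) (hF : IsHolSemigroup D F)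
    (hε : 0 ≤ ε) (hz : z ∈ D) :
    HasDerivWithinAt (fun t => timeIntegral Γ ε (F t z) * Γ t z) (Γ ε z - 1) (Ici 0) 0 := by
  have hwindow := hasDerivWithinAt_integral_window (hΓ.continuous.uncurry_right z hz) hε le_rfl
  rw [zero_add, hΓ.zero z hz] at hwindow
  exact hwindow.congr_of_mem (fun t ht => hΓ.timeIntegral_mul hF hε ht hz) self_mem_Ici

theorem exists_pos_isUnit_timeIntegral (hΓ : IsSemicocycle D F Γ) (hz : z ∈ D) :
    ∃ ε > 0, IsUnit (timeIntegral Γ ε z) := by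
  simpa only [zero_add, timeIntegral] using
    exists_pos_isUnit_integral (hΓ.continuous.uncurry_right z hz) ((hΓ.zero z hz).symm ▸ isUnit_one)

theorem differentiableWithinAt_zero (hΓ : IsSemicocycle D F Γ) (hF : IsHolSemigroup D F)
    (hD : IsOpen D) (hz : z ∈ D) : DifferentiableWithinAt ℝ (fun t => Γ t z) (Ici 0) 0 := by
  obtain ⟨ε, hε, hunit⟩ := hΓ.exists_pos_isUnit_timeIntegral hz
  rw [← hF.zero z hz] at hunit
  have hG : DifferentiableWithinAt ℝ (fun t => timeIntegral Γ ε (F t z)) (Ici 0) 0 :=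
    (hF.hasDerivWithinAt_comp_orbit hD
      (differentiableOn_timeIntegral hD hΓ.continuous hΓ.holomorphic hε.le) hz)
      |>.differentiableWithinAt
  have hinv := (differentiableAt_inverse (𝕜 := ℝ) hunit).comp_differentiableWithinAt 0 hG
  refine (hinv.mul (hΓ.hasDerivWithinAt_timeIntegral_mul hF hε.le hz).differentiableWithinAt)
    |>.congr_of_eventuallyEq_of_mem ?_ self_mem_Ici
  filter_upwards [hG.continuousWithinAt.eventually (Units.isOpen.mem_nhds hunit)] with t ht
  exact (Ring.inverse_mul_cancel_left _ _ ht).symm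

theorem hasDerivWithinAt_zero (hΓ : IsSemicocycle D F Γ) (hF : IsHolSemigroup D F)
    (hD : IsOpen D) (hz : z ∈ D) :
    HasDerivWithinAt (fun t => Γ t z) (semicocycleGenerator Γ z) (Ici 0) 0 :=
  (hΓ.differentiableWithinAt_zero hF hD hz).hasDerivWithinAt

theorem timeIntegral_mul_semicocycleGenerator (hΓ : IsSemicocycle D F Γ)
    (hF : IsHolSemigroup D F) (hD : IsOpen D) (hε : 0 ≤ ε) (hz : z ∈ D) :
    timeIntegral Γ ε z * semicocycleGenerator Γ z =
      Γ ε z - 1 - semigroupGenerator F z • deriv (timeIntegral Γ ε) z := by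
  have hprod := (hF.hasDerivWithinAt_comp_orbit hD
    (differentiableOn_timeIntegral hD hΓ.continuous hΓ.holomorphic hε) hz).mul
    (hΓ.hasDerivWithinAt_zero hF hD hz)
  rw [hF.zero z hz, hΓ.zero z hz, mul_one] at hprod
  exact eq_sub_of_add_eq' ((uniqueDiffWithinAt_Ici 0).eq_deriv _ hprod
    (hΓ.hasDerivWithinAt_timeIntegral_mul hF hε hz))

theorem differentiableOn_semicocycleGenerator (hΓ : IsSemicocycle D F Γ)
    (hF : IsHolSemigroup D F) (hD : IsOpen D) :
    DifferentiableOn ℂ (semicocycleGenerator Γ) D := by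
  intro z hz
  obtain ⟨ε, hε, hunit⟩ := hΓ.exists_pos_isUnit_timeIntegral hz
  have hGD := differentiableOn_timeIntegral hD hΓ.continuous hΓ.holomorphic hε.le
  have hG : DifferentiableAt ℂ (timeIntegral Γ ε) z := hGD.differentiableAt (hD.mem_nhds hz)
  have hinv : DifferentiableAt ℂ (fun w => Ring.inverse (timeIntegral Γ ε w)) z :=
    (differentiableAt_inverse (𝕜 := ℂ) hunit).comp z hG
  have hrhs : DifferentiableAt ℂ
      (fun w => Γ ε w - 1 - semigroupGenerator F w • deriv (timeIntegral Γ ε) w) z :=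
    (((hΓ.holomorphic ε hε.le).sub_const 1).sub
      ((hF.differentiableOn_semigroupGenerator hD).smul (hGD.deriv hD))).differentiableAt
      (hD.mem_nhds hz)
  refine ((hinv.mul hrhs).congr_of_eventuallyEq ?_).differentiableWithinAt
  filter_upwards [hD.mem_nhds hz, hG.continuousAt.eventually (Units.isOpen.mem_nhds hunit)]
    with w hw hwunit
  rw [Pi.mul_apply, ← hΓ.timeIntegral_mul_semicocycleGenerator hF hD hε.le hw,
    Ring.inverse_mul_cancel_left _ _ hwunit]

theorem hasDerivWithinAt_Ici (hΓ : IsSemicocycle D F Γ) (hF : IsHolSemigroup D F)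
    (hD : IsOpen D) (hz : z ∈ D) (ht : 0 ≤ t) :
    HasDerivWithinAt (fun s => Γ s z) (semicocycleGenerator Γ (F t z) * Γ t z) (Ici t) t := by
  have hzero : HasDerivWithinAt (fun s => Γ s (F t z) * Γ t z)
      (semicocycleGenerator Γ (F t z) * Γ t z) (Ici 0) (t + -t) := by
    rw [add_neg_cancel]
    exact (hΓ.hasDerivWithinAt_zero hF hD (hF.mapsTo t ht hz)).mul_const (Γ t z)
  have hmaps : MapsTo (· + -t) (Ici t) (Ici 0) := fun s (hs : t ≤ s) => sub_nonneg.2 hs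
  refine (hasDerivWithinAt_comp_add hzero hmaps).congr_of_mem (fun s hs => ?_) self_mem_Ici
  rw [hΓ.chain (s + -t) t (hmaps hs) ht z hz, neg_add_cancel_right]

theorem solvesEvolution (hΓ : IsSemicocycle D F Γ) (hF : IsHolSemigroup D F) (hD : IsOpen D)
    (hz : z ∈ D) :
    SolvesEvolution (fun t => semicocycleGenerator Γ (F t z)) (fun t => Γ t z) := by
  have ha := hF.continuousOn_comp_orbit
    (hΓ.differentiableOn_semicocycleGenerator hF hD).continuousOn hz
  have hseries := solvesEvolution_peanoBaker ha
  exact hseries.congr (hseries.eqOn_of_hasDerivWithinAt_Ici ha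
    (hΓ.continuous.uncurry_right z hz) (fun t ht => hΓ.hasDerivWithinAt_Ici hF hD hz ht)
    (hΓ.zero z hz))

end IsSemicocycle

theorem theorem2p2_general {A : Type*} [NormedRing A] [NormedAlgebra ℂ A] [CompleteSpace A]
    {D : Set ℂ} (hD : IsOpen D) {F : ℝ → ℂ → ℂ} (hF : IsHolSemigroup D F) :
    (∀ B : ℂ → A, DifferentiableOn ℂ B D →
      (∀ z ∈ D, ∃ v : ℝ → A, IsUniqueEvolutionSolution (fun t => B (F t z)) v) ∧
      ∀ u : ℝ → ℂ → A,
        (∀ z ∈ D, SolvesEvolution (fun t => B (F t z)) (fun t => u t z)) →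
        IsSemicocycle D F u) ∧
    (∀ Γ : ℝ → ℂ → A, IsSemicocycle D F Γ →
      (∀ z ∈ D, DifferentiableOn ℝ (fun t => Γ t z) (Ici 0)) ∧
      DifferentiableOn ℂ (semicocycleGenerator Γ) D ∧
      ∀ z ∈ D, IsUniqueEvolutionSolution (fun t => semicocycleGenerator Γ (F t z))
        (fun t => Γ t z)) := by
  refine ⟨fun B hB => ⟨fun z hz => ?_, fun u => hF.isSemicocycle_of_solvesEvolution hD hB⟩,
    fun Γ hΓ => ⟨fun z hz t ht => ?_, hΓ.differentiableOn_semicocycleGenerator hF hD,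
      fun z hz => ?_⟩⟩
  · have ha := hF.continuousOn_comp_orbit hB.continuousOn hz
    exact ⟨_, (solvesEvolution_peanoBaker ha).isUnique ha⟩
  · exact ((hΓ.solvesEvolution hF hD hz).1 t ht).differentiableWithinAt
  · exact (hΓ.solvesEvolution hF hD hz).isUnique (hF.continuousOn_comp_orbit
      (hΓ.differentiableOn_semicocycleGenerator hF hD).continuousOn hz)

theorem theorem2p2 {A : Type*} [NormedRing A] [NormOneClass A] [NormedAlgebra ℂ A]
    [CompleteSpace A] (F : ℝ → ℂ → ℂ) (hF : IsHolSemigroup (ball (0 : ℂ) 1) F) :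
    (∀ B : ℂ → A, DifferentiableOn ℂ B (ball (0 : ℂ) 1) →
      (∀ z ∈ ball (0 : ℂ) 1, ∃ v : ℝ → A,
        IsUniqueEvolutionSolution (fun t => B (F t z)) v) ∧
      ∀ u : ℝ → ℂ → A,
        (∀ z ∈ ball (0 : ℂ) 1, SolvesEvolution (fun t => B (F t z)) (fun t => u t z)) →
        IsSemicocycle (ball (0 : ℂ) 1) F u) ∧
    (∀ Γ : ℝ → ℂ → A, IsSemicocycle (ball (0 : ℂ) 1) F Γ →
      (∀ z ∈ ball (0 : ℂ) 1, DifferentiableOn ℝ (fun t => Γ t z) (Ici 0)) ∧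
      DifferentiableOn ℂ (semicocycleGenerator Γ) (ball (0 : ℂ) 1) ∧
      ∀ z ∈ ball (0 : ℂ) 1,
        IsUniqueEvolutionSolution (fun t => semicocycleGenerator Γ (F t z))
          (fun t => Γ t z)) :=
  theorem2p2_general isOpen_ball hF
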